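/- Let $T,r_0>0$, $D\in\mathbb R$, and let $0<t_1^k<t_2^k<T$ ($k\in\mathbb N$) with $t_1^k\to 0$ and $t_2^k\to T$ as $k\to\infty$. For each $i\in\mathbb N$ let $U_T^i$ be a three-dimensional Riemannian region foliated by a solution $\Sigma_t^i$, $t\in[0,T]$, of inverse mean curvature flow $\partial_t F_i=\nu/H_i$ starting from a sphere; that is, in the coordinates $(x,t)\in S^2\times[0,T]$ given by the flow, $U_T^i=(S^2\times[0,T],\hat g^i)$ with $\Sigma^i_t=S^2\times\{t\}$ and $$\hat g^i=\frac{1}{H_i(x,t)^2}\,dt^2+g^i(x,t),$$ where $g^i(\cdot,t)$ is the induced metric of $\Sigma_t^i$, $\nu=H_i\partial_t$ its outward unit normal, $A^i$ its second fundamental form with respect to $\nu$, and $H_i=\operatorname{tr}_{g^i}A^i>0$ its mean curvature. The metric and $H_i$ are smooth for $0<t<T$, and the metrics $g^i(\cdot,t)$ extend continuously to Riemannian metrics at $t=0$ and $t=T$. Write $U_T^{i,k}=S^2\times[t_1^k,t_2^k]\subset U_T^i$. For a region or a leaf $U$, let $d_U$ denote its intrinsic distance, i.e. the infimum of the lengths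 of curves that stay in $U$; let $\sigma$ be the round metric of the unit sphere and $S^2(r)=(S^2,r^2\sigma)$ the round sphere of radius $r$. Assume: 1. $\operatorname{Diam}(\Sigma_t^i)\le D$ (intrinsic diameter) for all $i$ and all $t\in[0,T]$; 2. there is $h\in L^1([0,T])$ with $\dfrac1{H_i(x,t)}\le h(t)$ for all $i$, $x\in S^2$, $t\in(0,T)$; 3. $\displaystyle\liminf_{i\to\infty}d_{\Sigma_0^i}(\theta_1,\theta_2)\ge d_{S^2(r_0)}(\theta_1,\theta_2)$ for all $\theta_1,\theta_2\in S^2$; 4. for each fixed $k$ and $j=1,2$, the leaves $\Sigma^i_{t_j^k}$ converge in $C^0$ to $S^2(r_0e^{t_j^k/2})$, i.e. $g^i(\cdot,t_j^k)\to r_0^2e^{t_j^k}\sigma$ uniformly on $S^2$ as $i\to\infty$; 5. for some fixed $K\in\mathbb N$ and all $i$, $A^i(\cdot,\cdot)>0$ on $U_T^i\setminus(U_T^{i,K}\cup\partial U_T^i)$, i.e. on the leaves $\Sigma_t^i$ with $t\in(0,t_1^K)\cup(t_2^K,T)$. Then $$\lim_{k\to\infty}\ \limsup_{i\to\infty}\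 \sup_{p,q\in U_T^{i,k}}\bigl(d_{U_T^{i,k}}(p,q)-d_{U_T^i}(p,q)\bigr)=0 .$$ -/

import Mathlib

open Set Filter Topology MeasureTheory
open scoped RealInnerProductSpace ENNReal ContDiff

noncomputable section

namespace IMCF

/-- The space `ℝ³`, in which the parametrizing sphere `S²` is the unit sphere. -/
abbrev E3 : Type := EuclideanSpace ℝ (Fin 3)

/-- The space `ℝ³ × ℝ`, which contains `S² × [0,T]`. -/
abbrev Pt : Type := E3 × ℝ

/-- A field of bilinear forms on `ℝ³ × ℝ`. Only its values at points of `S² × [0,T]` on vectors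
tangent to `S² × ℝ` are meaningful; the rest is an auxiliary extension. -/
abbrev BilinField : Type := Pt → Pt →L[ℝ] Pt →L[ℝ] ℝ

/-- The unit sphere `S²`. -/
def S2 : Set E3 := Metric.sphere 0 1

/-- `U_a^b = {(x,t) : x ∈ S², a ≤ t ≤ b}`, the union of the leaves `Σ_t`, `t ∈ [a,b]`. -/
def region (a b : ℝ) : Set Pt := S2 ×ˢ Icc a b

/-- The leaf `Σ_t = S² × {t}`. -/
def leaf (t : ℝ) : Set Pt := S2 ×ˢ {t}

/-- `v` is tangent to `S² × ℝ` at `p = (x,t)`: its first component is orthogonal to `x`. -/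
def IsTangent (p v : Pt) : Prop := ⟪p.1, v.1⟫ = 0

/-- `v` is tangent at `p` to the leaf through `p`. -/
def IsLeafTangent (p v : Pt) : Prop := IsTangent p v ∧ v.2 = 0

/-- The restriction of a bilinear form to the directions of the leaves. -/
def leafForm (B : Pt →L[ℝ] Pt →L[ℝ] ℝ) : E3 →L[ℝ] E3 →L[ℝ] ℝ :=
  B.bilinearComp (ContinuousLinearMap.inl ℝ E3 ℝ) (ContinuousLinearMap.inl ℝ E3 ℝ)

/-- Length of a curve `γ : [0,1] → S² × [0,T]` with respect to `G`. -/
def length (G : BilinField) (γ : ℝ → Pt) : ℝ≥0∞ :=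
  ∫⁻ s in Icc (0 : ℝ) 1, ENNReal.ofReal √(G (γ s) (deriv γ s) (deriv γ s))

/-- The Lipschitz curves from `p` to `q` inside `U`. (On these regions and leaves they give the same
infimum of lengths as piecewise `C¹` curves.) -/
def curves (U : Set Pt) (p q : Pt) : Set (ℝ → Pt) :=
  {γ | (∃ C, LipschitzOnWith C γ (Icc 0 1)) ∧ MapsTo γ (Icc 0 1) U ∧ γ 0 = p ∧ γ 1 = q}

/-- The intrinsic (length) distance `d_U` of a subset `U`: the infimum of the `G`-lengths of the
curves from `p` to `q` that stay in `U`. For `U = leaf t` this is the Riemannian distance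
of `Σ_t` with its induced metric. -/
def dist (G : BilinField) (U : Set Pt) (p q : Pt) : ℝ≥0∞ :=
  ⨅ γ ∈ curves U p q, length G γ

/-- Diameter of `U` with respect to its intrinsic distance. -/
def diam (G : BilinField) (U : Set Pt) : ℝ≥0∞ :=
  ⨆ p ∈ U, ⨆ q ∈ U, dist G U p q

/-- The distance of the round sphere `S²(r)` of radius `r`, in terms of points of `S²`. -/
def roundDist (r : ℝ) (θ₁ θ₂ : E3) : ℝ≥0∞ :=
  ENNReal.ofReal (r * InnerProductGeometry.angle θ₁ θ₂)

/-- `G` is the metric of the region `S² × [0,T]`. It is smooth for `0 < t < T` and the induced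
metrics of the leaves extend continuously to the Riemannian metrics of `Σ_0` and `Σ_T`; nothing is
asked about the behaviour of the other components of `G` as `t → 0` or `t → T`, so that `H` may
tend to `0` or be unbounded there. (A smooth tensor on `S² × (0,T)` has a smooth extension
to `(ℝ³ \ {0}) × (0,T)`.) -/
structure IsRegionMetric (T : ℝ) (G : BilinField) : Prop where
  smooth : ContDiffOn ℝ ∞ G (({0}ᶜ : Set E3) ×ˢ Ioo 0 T)
  leaf_continuous : ContinuousOn (fun p => leafForm (G p)) (region 0 T)
  symm : ∀ p ∈ region 0 T, ∀ v w, IsTangent p v → IsTangent p w → G p v w = G p w v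
  pos : ∀ p ∈ region 0 T, ∀ v, IsTangent p v → v ≠ 0 → 0 < G p v v

/-- `n` is the unit normal at `p` of the leaf through `p`, pointing outward (to larger `t`). -/
def IsOutwardUnitNormal (G : BilinField) (p n : Pt) : Prop :=
  IsTangent p n ∧ (∀ v, IsLeafTangent p v → G p n v = 0) ∧ G p n n = 1 ∧ 0 < n.2

/-- The second fundamental form `A(v,w) = G(∇_v ν, w) = ½ (L_ν G)(v,w)`, for `v, w` tangent
to the leaf, of the leaves of a foliation with field of unit normals `ν`; the Lie derivative is
written in the linear coordinates of `ℝ³ × ℝ`. -/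
def secondFundamentalForm (G : BilinField) (ν : Pt → Pt) (p v w : Pt) : ℝ :=
  (fderiv ℝ G p (ν p) v w + G p (fderiv ℝ ν p v) w + G p v (fderiv ℝ ν p w)) / 2

/-- `c` is the mean curvature at `p` of the leaf through `p`: the trace of the second fundamental
form, computed in orthonormal bases of the tangent plane of the leaf. -/
def IsMeanCurvature (G : BilinField) (ν : Pt → Pt) (p : Pt) (c : ℝ) : Prop :=
  ∀ e₁ e₂, IsLeafTangent p e₁ → IsLeafTangent p e₂ →
    G p e₁ e₁ = 1 → G p e₂ e₂ = 1 → G p e₁ e₂ = 0 →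
    secondFundamentalForm G ν p e₁ e₁ + secondFundamentalForm G ν p e₂ e₂ = c

/-- The field `H ∂_t`. -/
def normalField (H : Pt → ℝ) (p : Pt) : Pt := H p • ((0 : E3), (1 : ℝ))

/-- `(S² × [0,T], G)` is a region foliated by a solution `Σ_t` of inverse mean curvature flow,
with mean curvature `H > 0`, in the coordinates `(x,t)` given by the flow map `F(x,t)`. In these
coordinates `∂F/∂t = ∂_t`, and the equation `∂F/∂t = ν / H` says that `ν = H ∂_t` is the outward
unit normal of the leaves, where `H` is their mean curvature. -/
structure IsSolution (T : ℝ) (G : BilinField) (H : Pt → ℝ) : Prop where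
  metric : IsRegionMetric T G
  smooth : ContDiffOn ℝ ∞ H (({0}ᶜ : Set E3) ×ˢ Ioo 0 T)
  pos : ∀ x ∈ S2, ∀ t ∈ Ioo 0 T, 0 < H (x, t)
  normal : ∀ x ∈ S2, ∀ t ∈ Ioo 0 T, IsOutwardUnitNormal G (x, t) (normalField H (x, t))
  mean : ∀ x ∈ S2, ∀ t ∈ Ioo 0 T, IsMeanCurvature G (normalField H) (x, t) (H (x, t))

/-- The second fundamental form of the leaf through `p` is positive definite. -/
def SecondFundamentalFormPos (G : BilinField) (H : Pt → ℝ) (p : Pt) : Prop :=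
  ∀ v, IsLeafTangent p v → v ≠ 0 → 0 < secondFundamentalForm G (normalField H) p v v

/-- The induced metrics of the leaves `Σ_t^i` converge in `C⁰`, as `i → ∞`, to the metric `r² σ` of
the round sphere `S²(r)`. -/
def LeafTendstoRound (G : ℕ → BilinField) (t r : ℝ) : Prop :=
  ∀ ε > 0, ∀ᶠ i in atTop, ∀ x ∈ S2, ∀ v : E3, ⟪x, v⟫ = 0 →
    |G i (x, t) (v, 0) (v, 0) - r ^ 2 * ‖v‖ ^ 2| ≤ ε * ‖v‖ ^ 2

/-- `sup_{p,q ∈ V} (d_V(p,q) - d_U(p,q))` for `V ⊆ U` (so that `d_U ≤ d_V`). -/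
def embeddingConstant (G : BilinField) (V U : Set Pt) : ℝ≥0∞ :=
  ⨆ p ∈ V, ⨆ q ∈ V, (dist G V p q - dist G U p q)

end IMCF

end

namespace IMCF

/-! Write `U = S² × [0,T]` and `V = S² × [a,b]`, with `a = t₁ k`, `b = t₂ k`. Clamping the
`t`-coordinate to `[a,b]` turns a curve in `U` with endpoints in `V` into a curve in `V` with the
same endpoints, so it is enough to see that clamping hardly lengthens curves. For `0 < t < T` the
metric is `dt² / H² + g`. Outside `V` clamping drops the `dt`-part of a velocity and carries its
horizontal part along a vertical line to the leaf at `a` or `b`. On the leaves crossed, `∂_t g = 2 A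
/ H`; since `A > 0` and `tr A = H`, both eigenvalues of `A` lie between `0` and `H`, so `0 ≤ ∂_t g ≤
2 g` (`IsSolution.deriv_leaf_bounds`). Hence moving down to `b` does not lengthen vectors, and
moving up to `a` multiplies `g` by at most `exp (2 a)` (`IsSolution.clamp_speed_le`). Therefore `d_V
≤ exp a · d_U`, and `d_V - d_U ≤ (exp a - 1) d_U`. A vertical segment followed by a path in a leaf
gives `d_U ≤ ∫ h + D` on `V`. The resulting bound does not depend on `i` and tends to `0` with `a`.
-/

/-- The coordinate field `∂_t`. -/
abbrev vertical : Pt := ((0 : E3), (1 : ℝ))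

theorem ne_zero_of_mem_S2 {x : E3} (hx : x ∈ S2) : x ≠ 0 := by
  rintro rfl
  simp [S2] at hx

theorem mem_smooth_domain {T t : ℝ} {x : E3} (hx : x ∈ S2) (ht : t ∈ Ioo 0 T) :
    (({0}ᶜ : Set E3) ×ˢ Ioo 0 T) ∈ 𝓝 ((x, t) : Pt) :=
  (isOpen_compl_singleton.prod isOpen_Ioo).mem_nhds ⟨ne_zero_of_mem_S2 hx, ht⟩

/-! ### Leaf metrics under the flow: splitting, derivative in `t`, growth bounds. -/

section Solution

variable {T : ℝ} {G : BilinField} {H : Pt → ℝ}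

theorem IsSolution.vertical_apply (hs : IsSolution T G H) {x : E3} (hx : x ∈ S2) {t : ℝ}
    (ht : t ∈ Ioo 0 T) {v : Pt} (hv : IsLeafTangent (x, t) v) : G (x, t) vertical v = 0 := by
  have h := (hs.normal x hx t ht).2.1 v hv
  simp only [normalField, map_smul, smul_apply, smul_eq_mul] at h
  exact (mul_eq_zero.1 h).resolve_left (hs.pos x hx t ht).ne'

theorem IsSolution.apply_vertical (hs : IsSolution T G H) {x : E3} (hx : x ∈ S2) {t : ℝ}
    (ht : t ∈ Ioo 0 T) {v : Pt} (hv : IsLeafTangent (x, t) v) : G (x, t) v vertical = 0 := by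
  rw [hs.metric.symm (x, t) ⟨hx, Ioo_subset_Icc_self ht⟩ v vertical hv.1 (by simp [IsTangent])]
  exact hs.vertical_apply hx ht hv

theorem IsSolution.vertical_vertical (hs : IsSolution T G H) {x : E3} (hx : x ∈ S2) {t : ℝ}
    (ht : t ∈ Ioo 0 T) : G (x, t) vertical vertical = (1 / H (x, t)) ^ 2 := by
  have h := (hs.normal x hx t ht).2.2.1
  have hH := hs.pos x hx t ht
  simp only [normalField, map_smul, smul_apply, smul_eq_mul] at h
  field_simp
  linarith

/-- The metric splits as `dt² / H² + g`. -/
theorem IsSolution.metric_split (hs : IsSolution T G H) {x : E3} (hx : x ∈ S2) {t : ℝ}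
    (ht : t ∈ Ioo 0 T) {v : E3} (hv : ⟪x, v⟫ = 0) (τ : ℝ) :
    G (x, t) (v, τ) (v, τ) = G (x, t) (v, 0) (v, 0) + (τ / H (x, t)) ^ 2 := by
  have hl : IsLeafTangent (x, t) (v, 0) := ⟨hv, rfl⟩
  have e : ((v, τ) : Pt) = (v, 0) + τ • vertical := by simp
  rw [e]
  simp only [map_add, map_smul, add_apply, smul_apply, smul_eq_mul,
    hs.vertical_apply hx ht hl, hs.apply_vertical hx ht hl, hs.vertical_vertical hx ht]
  ring

/-- The second fundamental form is half the `ν`-derivative of the leaf metrics. -/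
theorem IsSolution.secondFundamentalForm_eq (hs : IsSolution T G H) {x : E3} (hx : x ∈ S2) {t : ℝ}
    (ht : t ∈ Ioo 0 T) {v : Pt} (hv : IsLeafTangent (x, t) v) :
    secondFundamentalForm G (normalField H) (x, t) v v =
      H (x, t) * fderiv ℝ G (x, t) vertical v v / 2 := by
  have hd : DifferentiableAt ℝ H (x, t) :=
    (hs.smooth.contDiffAt (mem_smooth_domain hx ht)).differentiableAt (by simp)
  have hf : fderiv ℝ (normalField H) (x, t) v = (fderiv ℝ H (x, t) v) • vertical := by
    unfold normalField
    rw [fderiv_smul_const hd]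
    rfl
  unfold secondFundamentalForm
  rw [hf]
  simp only [normalField, map_smul, smul_apply, smul_eq_mul,
    hs.vertical_apply hx ht hv, hs.apply_vertical hx ht hv]
  ring

theorem IsSolution.hasDerivAt_leaf (hs : IsSolution T G H) {x : E3} (hx : x ∈ S2) {t : ℝ}
    (ht : t ∈ Ioo 0 T) (v : Pt) :
    HasDerivAt (fun s => G (x, s) v v) (fderiv ℝ G (x, t) vertical v v) t := by
  have hd : HasFDerivAt G (fderiv ℝ G (x, t)) (x, t) :=
    ((hs.metric.smooth.contDiffAt (mem_smooth_domain hx ht)).differentiableAt (by simp)).hasFDerivAt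
  have hc : HasDerivAt (fun s : ℝ => ((x, s) : Pt)) vertical t :=
    (hasDerivAt_const t x).prodMk (hasDerivAt_id t)
  have h : HasDerivAt (fun s => G (x, s)) (fderiv ℝ G (x, t) vertical) t :=
    HasFDerivAt.comp_hasDerivAt (𝕜 := ℝ) (l := G) (f := fun s : ℝ => ((x, s) : Pt)) t hd hc
  have h1 := h.clm_apply (hasDerivAt_const t v)
  have h2 := h1.clm_apply (hasDerivAt_const t v)
  simpa using h2

/-- Lets the derivative bounds on `(0,T)` be integrated up to `t = 0` and `t = T`, where only the
leaf components of `G` are known to be continuous. -/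
theorem IsSolution.continuousOn_leaf (hs : IsSolution T G H) {x : E3} (hx : x ∈ S2) (v : E3) :
    ContinuousOn (fun s => G (x, s) (v, 0) (v, 0)) (Icc 0 T) := by
  have hc : ContinuousOn (fun s : ℝ => leafForm (G (x, s))) (Icc 0 T) :=
    hs.metric.leaf_continuous.comp (by fun_prop) (fun s hs => ⟨hx, hs⟩)
  exact (hc.clm_apply continuousOn_const).clm_apply continuousOn_const

/-- A nonzero tangent vector of the leaf has a nonzero orthogonal one. -/
theorem exists_orthogonal (hG : IsRegionMetric T G) {x : E3} (hx : x ∈ S2) {t : ℝ}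
    (ht : t ∈ Icc 0 T) {v : E3} (hv : ⟪x, v⟫ = 0) (hv0 : v ≠ 0) :
    ∃ w : E3, ⟪x, w⟫ = 0 ∧ w ≠ 0 ∧ G (x, t) (v, 0) (w, 0) = 0 := by
  -- In dimension 3 some `w ≠ 0` is Euclidean-orthogonal to `x` and `v`; one Gram–Schmidt step then
  -- makes it `G`-orthogonal to `v`.
  obtain ⟨w, hw, hw0⟩ : ∃ w ∈ (Submodule.span ℝ ({x, v} : Set E3))ᗮ, w ≠ 0 := by
    refine Submodule.exists_mem_ne_zero_of_ne_bot fun hb => ?_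
    rw [Submodule.orthogonal_eq_bot_iff] at hb
    have h1 : Module.finrank ℝ (Submodule.span ℝ (({x, v} : Finset E3) : Set E3)) ≤ 2 :=
      (finrank_span_finset_le_card _).trans Finset.card_le_two
    rw [Finset.coe_pair, hb, finrank_top] at h1
    simp at h1
  have hwx : ⟪x, w⟫ = 0 := hw x (Submodule.subset_span (by simp))
  have hwv : ⟪v, w⟫ = 0 := hw v (Submodule.subset_span (by simp))
  have hpos : 0 < G (x, t) (v, 0) (v, 0) :=
    hG.pos (x, t) ⟨hx, ht⟩ (v, 0) hv (by simpa using hv0)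
  set c := G (x, t) (v, 0) (w, 0) / G (x, t) (v, 0) (v, 0) with hc
  refine ⟨w - c • v, by simp [inner_sub_right, inner_smul_right, hwx, hv], fun h => ?_, ?_⟩
  · rw [sub_eq_zero] at h
    apply hw0
    rw [← inner_self_eq_zero (𝕜 := ℝ)]
    nth_rewrite 1 [h]
    rw [inner_smul_left, hwv, mul_zero]
  · have e : ((w - c • v, 0) : Pt) = (w, 0) - c • (v, 0) := by simp
    rw [e, map_sub, map_smul, smul_eq_mul, hc]
    field_simp
    simp

/-- Positivity of `A` and `tr A = H` bound the logarithmic derivative of the leaf metrics. -/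
theorem IsSolution.deriv_leaf_bounds (hs : IsSolution T G H) {x : E3} (hx : x ∈ S2) {t : ℝ}
    (ht : t ∈ Ioo 0 T) (hA : SecondFundamentalFormPos G H (x, t)) {v : E3} (hv : ⟪x, v⟫ = 0) :
    0 ≤ fderiv ℝ G (x, t) vertical (v, 0) (v, 0) ∧
      fderiv ℝ G (x, t) vertical (v, 0) (v, 0) ≤ 2 * G (x, t) (v, 0) (v, 0) := by
  rcases eq_or_ne v 0 with rfl | hv0
  · have : ((0, 0) : Pt) = 0 := rfl
    simp [this]
  have hH := hs.pos x hx t ht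
  have htI := Ioo_subset_Icc_self ht
  obtain ⟨w, hw, hw0, hvw⟩ := exists_orthogonal hs.metric hx htI hv hv0
  have hlv : IsLeafTangent (x, t) (v, 0) := ⟨hv, rfl⟩
  have hlw : IsLeafTangent (x, t) (w, 0) := ⟨hw, rfl⟩
  have hgv : 0 < G (x, t) (v, 0) (v, 0) :=
    hs.metric.pos (x, t) ⟨hx, htI⟩ (v, 0) hv (by simpa using hv0)
  have hgw : 0 < G (x, t) (w, 0) (w, 0) :=
    hs.metric.pos (x, t) ⟨hx, htI⟩ (w, 0) hw (by simpa using hw0)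
  have hAv := hA (v, 0) hlv (by simpa using hv0)
  have hAw := hA (w, 0) hlw (by simpa using hw0)
  have leaf_smul : ∀ (a : ℝ) {u : Pt}, IsLeafTangent (x, t) u → IsLeafTangent (x, t) (a • u) := by
    rintro a u ⟨h1, h2⟩
    refine ⟨?_, by simp [h2]⟩
    have h1' : ⟪x, u.1⟫ = 0 := h1
    simp [IsTangent, inner_smul_right, h1']
  have norm_one : ∀ {u : Pt}, 0 < G (x, t) u u →
      G (x, t) ((√(G (x, t) u u))⁻¹ • u) ((√(G (x, t) u u))⁻¹ • u) = 1 := by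
    intro u hu
    simp only [map_smul, smul_apply, smul_eq_mul]
    rw [← mul_assoc, ← mul_inv, Real.mul_self_sqrt hu.le, inv_mul_cancel₀ hu.ne']
  have hm := hs.mean x hx t ht _ _ (leaf_smul (√(G (x, t) (v, 0) (v, 0)))⁻¹ hlv)
    (leaf_smul (√(G (x, t) (w, 0) (w, 0)))⁻¹ hlw) (norm_one hgv) (norm_one hgw)
    (by simp only [map_smul, smul_apply, smul_eq_mul, hvw, mul_zero])
  rw [hs.secondFundamentalForm_eq hx ht (leaf_smul _ hlv),
    hs.secondFundamentalForm_eq hx ht (leaf_smul _ hlw)] at hm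
  rw [hs.secondFundamentalForm_eq hx ht hlv] at hAv
  rw [hs.secondFundamentalForm_eq hx ht hlw] at hAw
  have sq_inv : ∀ {a b : ℝ}, 0 < a → (√a)⁻¹ * ((√a)⁻¹ * b) = b / a := by
    intro a b ha
    rw [← mul_assoc, ← mul_inv, Real.mul_self_sqrt ha.le, div_eq_inv_mul]
  simp only [map_smul, smul_apply, smul_eq_mul] at hm
  rw [sq_inv hgv, sq_inv hgw] at hm
  set dv := fderiv ℝ G (x, t) vertical (v, 0) (v, 0)
  set dw := fderiv ℝ G (x, t) vertical (w, 0) (w, 0)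
  have hdv : 0 < dv := by
    by_contra! hneg
    nlinarith [mul_nonneg hH.le (neg_nonneg.2 hneg)]
  have hdw : 0 < dw := by
    by_contra! hneg
    nlinarith [mul_nonneg hH.le (neg_nonneg.2 hneg)]
  refine ⟨hdv.le, ?_⟩
  -- The factor `H` from `ν = H ∂_t` cancels the `H` of `tr A = H`: the two logarithmic derivatives
  -- add up to 2, and both are positive.
  have hsum : dv / G (x, t) (v, 0) (v, 0) + dw / G (x, t) (w, 0) (w, 0) = 2 := by
    refine mul_left_cancel₀ hH.ne' ?_
    linarith
  have hq : 0 < dw / G (x, t) (w, 0) (w, 0) := div_pos hdw hgw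
  rw [← div_le_iff₀ hgv]
  linarith

/-- Leaf metrics increase through leaves with positive second fundamental form. -/
theorem IsSolution.leaf_le_leaf (hs : IsSolution T G H) {a b : ℝ} (ha : 0 ≤ a) (hab : a ≤ b)
    (hb : b ≤ T) {x : E3} (hx : x ∈ S2)
    (hA : ∀ t ∈ Ioo a b, SecondFundamentalFormPos G H (x, t)) {v : E3} (hv : ⟪x, v⟫ = 0) :
    G (x, a) (v, 0) (v, 0) ≤ G (x, b) (v, 0) (v, 0) := by
  have hI : Ioo a b ⊆ Ioo 0 T := Ioo_subset_Ioo ha hb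
  refine monotoneOn_of_deriv_nonneg (convex_Icc a b)
    ((hs.continuousOn_leaf hx v).mono (Icc_subset_Icc ha hb)) ?_ ?_ (left_mem_Icc.2 hab)
    (right_mem_Icc.2 hab) hab
  · rw [interior_Icc]
    exact fun t ht => (hs.hasDerivAt_leaf hx (hI ht) _).differentiableAt.differentiableWithinAt
  · rw [interior_Icc]
    intro t ht
    rw [(hs.hasDerivAt_leaf hx (hI ht) _).deriv]
    exact (hs.deriv_leaf_bounds hx (hI ht) (hA t ht) hv).1

/-- Through leaves with positive second fundamental form, the leaf metrics grow at most
like `exp (2 t)`. -/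
theorem IsSolution.leaf_le_exp_mul_leaf (hs : IsSolution T G H) {a b : ℝ} (ha : 0 ≤ a)
    (hab : a ≤ b) (hb : b ≤ T) {x : E3} (hx : x ∈ S2)
    (hA : ∀ t ∈ Ioo a b, SecondFundamentalFormPos G H (x, t)) {v : E3} (hv : ⟪x, v⟫ = 0) :
    G (x, b) (v, 0) (v, 0) ≤ Real.exp (2 * (b - a)) * G (x, a) (v, 0) (v, 0) := by
  have hI : Ioo a b ⊆ Ioo 0 T := Ioo_subset_Ioo ha hb
  -- Grönwall: `∂_t g ≤ 2 g` makes `exp (-2 t) g` nonincreasing.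
  have hd : ∀ t ∈ Ioo a b, HasDerivAt
      (fun s => Real.exp (-(2 * s)) * G (x, s) (v, 0) (v, 0))
      (Real.exp (-(2 * t)) * (-(2 * 1)) * G (x, t) (v, 0) (v, 0) +
        Real.exp (-(2 * t)) * fderiv ℝ G (x, t) vertical (v, 0) (v, 0)) t := fun t ht =>
    (((hasDerivAt_id t).const_mul 2).neg.exp).mul (hs.hasDerivAt_leaf hx (hI ht) _)
  have key := antitoneOn_of_deriv_nonpos (convex_Icc a b)
    (f := fun s => Real.exp (-(2 * s)) * G (x, s) (v, 0) (v, 0))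
    ((Continuous.continuousOn (by fun_prop)).mul
      ((hs.continuousOn_leaf hx v).mono (Icc_subset_Icc ha hb)))
    (by
      rw [interior_Icc]
      exact fun t ht => (hd t ht).differentiableAt.differentiableWithinAt)
    (by
      rw [interior_Icc]
      intro t ht
      rw [(hd t ht).deriv]
      have h2 := (hs.deriv_leaf_bounds hx (hI ht) (hA t ht) hv).2
      nlinarith [mul_nonneg (Real.exp_pos (-(2 * t))).le (sub_nonneg.2 h2)])
    (left_mem_Icc.2 hab) (right_mem_Icc.2 hab) hab
  have e : Real.exp (2 * (b - a)) = Real.exp (2 * b) * Real.exp (-(2 * a)) := by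
    rw [← Real.exp_add]
    ring_nf
  calc G (x, b) (v, 0) (v, 0)
      = Real.exp (2 * b) * (Real.exp (-(2 * b)) * G (x, b) (v, 0) (v, 0)) := by
        rw [← mul_assoc, ← Real.exp_add]
        simp
    _ ≤ Real.exp (2 * b) * (Real.exp (-(2 * a)) * G (x, a) (v, 0) (v, 0)) :=
        mul_le_mul_of_nonneg_left key (Real.exp_pos _).le
    _ = _ := by rw [e, mul_assoc]

end Solution

/-! ### The retraction onto `S² × [a,b]` and its effect on lengths. -/

section Clamp

/-- The retraction of `S² × ℝ` onto `S² × [a,b]` along the vertical lines. -/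
noncomputable def clamp (a b : ℝ) (p : Pt) : Pt := (p.1, max a (min p.2 b))

theorem lipschitzWith_clamp (a b : ℝ) : LipschitzWith 1 (clamp a b) := by
  refine LipschitzWith.of_dist_le_mul fun p q => ?_
  simp only [clamp, Prod.dist_eq, NNReal.coe_one, one_mul]
  refine max_le_max le_rfl ?_
  have h : LipschitzWith 1 fun t : ℝ => max a (min t b) :=
    (LipschitzWith.id.min_const b).const_max a
  simpa using h.dist_le_mul p.2 q.2

theorem clamp_eq_self {a b : ℝ} {p : Pt} (hp : p ∈ region a b) : clamp a b p = p := by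
  obtain ⟨_, h1, h2⟩ := hp
  simp [clamp, h1, h2]

theorem clamp_mem_region {a b : ℝ} (hab : a ≤ b) {p : Pt} (hp : p.1 ∈ S2) :
    clamp a b p ∈ region a b :=
  ⟨hp, le_max_left _ _, max_le hab (min_le_right _ _)⟩

theorem clamp_comp_mem_curves {a b : ℝ} (hab : a ≤ b) {U : Set Pt} (hU : ∀ p ∈ U, p.1 ∈ S2)
    {p q : Pt} (hp : p ∈ region a b) (hq : q ∈ region a b) {γ : ℝ → Pt} (hγ : γ ∈ curves U p q) :
    clamp a b ∘ γ ∈ curves (region a b) p q := by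
  obtain ⟨⟨C, hC⟩, hm, h0, h1⟩ := hγ
  refine ⟨⟨1 * C, ((lipschitzWith_clamp a b).lipschitzOnWith (s := univ)).comp hC
    (mapsTo_univ _ _)⟩, fun s hs => clamp_mem_region hab (hU _ (hm hs)), ?_, ?_⟩
  · simp [h0, clamp_eq_self hp]
  · simp [h1, clamp_eq_self hq]

theorem ae_differentiableAt_of_mem_curves {U : Set Pt} {p q : Pt} {γ : ℝ → Pt}
    (hγ : γ ∈ curves U p q) : ∀ᵐ s ∂volume.restrict (Ioo (0 : ℝ) 1), DifferentiableAt ℝ γ s := by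
  obtain ⟨⟨C, hC⟩, -⟩ := hγ
  rw [ae_restrict_iff' measurableSet_Ioo]
  have h := (hC.mono Ioo_subset_Icc_self).ae_differentiableWithinAt_of_mem (μ := volume)
  filter_upwards [h] with s hs hsI
  exact (hs hsI).differentiableAt (Ioo_mem_nhds hsI.1 hsI.2)

/-- Differentiate `|x|² = 1` along the curve. -/
theorem isTangent_of_hasDerivAt {γ : ℝ → Pt} {s : ℝ} {v : Pt} (hγ : HasDerivAt γ v s)
    (hm : ∀ᶠ u in 𝓝 s, (γ u).1 ∈ S2) : IsTangent (γ s) v := by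
  have h1 : HasDerivAt (fun u => (γ u).1) v.1 s := hγ.fst
  have h2 := h1.inner ℝ h1
  have h3 : (fun u => ⟪(γ u).1, (γ u).1⟫) =ᶠ[𝓝 s] fun _ => (1 : ℝ) := by
    filter_upwards [hm] with u hu
    have : ‖(γ u).1‖ = 1 := by simpa [S2] using hu
    rw [real_inner_self_eq_norm_sq, this, one_pow]
  have h4 := h2.unique ((hasDerivAt_const s (1 : ℝ)).congr_of_eventuallyEq h3)
  rw [real_inner_comm (γ s).1 v.1] at h4
  unfold IsTangent
  linarith

variable {T : ℝ} {G : BilinField} {H : Pt → ℝ}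

/-- Along a curve in the region, the horizontal part of the velocity is no longer than the
velocity; where the curve touches the boundary the velocity is horizontal. -/
theorem IsSolution.horizontal_le (hs : IsSolution T G H) {γ : ℝ → Pt} {s : ℝ} {v : Pt}
    (hγ : HasDerivAt γ v s) (hm : ∀ᶠ u in 𝓝 s, γ u ∈ region 0 T) :
    G (γ s) (v.1, 0) (v.1, 0) ≤ G (γ s) v v := by
  have htan : ⟪(γ s).1, v.1⟫ = 0 := isTangent_of_hasDerivAt hγ (hm.mono fun u hu => hu.1)
  obtain ⟨hx, h0, hT⟩ := hm.self_of_nhds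
  have h2 : HasDerivAt (fun u => (γ u).2) v.2 s := hγ.snd
  rcases h0.eq_or_lt with h0 | h0
  · have hmin : IsLocalMin (fun u => (γ u).2) s := by
      filter_upwards [hm] with u hu
      rw [← h0]
      exact hu.2.1
    have hv : v = (v.1, 0) := Prod.ext rfl (hmin.hasDerivAt_eq_zero h2)
    rw [← hv]
  rcases hT.eq_or_lt with hT | hT
  · have hmax : IsLocalMax (fun u => (γ u).2) s := by
      filter_upwards [hm] with u hu
      rw [hT]
      exact hu.2.2
    have hv : v = (v.1, 0) := Prod.ext rfl (hmax.hasDerivAt_eq_zero h2)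
    rw [← hv]
  · have h := hs.metric_split hx ⟨h0, hT⟩ htan v.2
    have : G (γ s) v v = G (γ s) (v.1, 0) (v.1, 0) + (v.2 / H (γ s)) ^ 2 := h
    rw [this]
    exact le_add_of_nonneg_right (sq_nonneg _)

/-- Clamping the `t`-coordinate multiplies the speed of a curve by at most `exp a`. -/
theorem IsSolution.clamp_speed_le (hs : IsSolution T G H) {a b : ℝ} (ha : 0 ≤ a) (hab : a < b)
    (hb : b ≤ T) (hA : ∀ x ∈ S2, ∀ t ∈ Ioo 0 a ∪ Ioo b T, SecondFundamentalFormPos G H (x, t))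
    {γ : ℝ → Pt} {s : ℝ} (hγ : DifferentiableAt ℝ γ s)
    (hcγ : DifferentiableAt ℝ (clamp a b ∘ γ) s) (hm : ∀ᶠ u in 𝓝 s, γ u ∈ region 0 T) :
    G ((clamp a b ∘ γ) s) (deriv (clamp a b ∘ γ) s) (deriv (clamp a b ∘ γ) s) ≤
      Real.exp (2 * a) * G (γ s) (deriv γ s) (deriv γ s) := by
  set v := deriv γ s with hv
  set w := deriv (clamp a b ∘ γ) s with hw
  have hγ' : HasDerivAt γ v s := hγ.hasDerivAt
  have hc' : HasDerivAt (clamp a b ∘ γ) w s := hcγ.hasDerivAt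
  have hfst : w.1 = v.1 := HasDerivAt.unique (f := fun u => (γ u).1) hc'.fst hγ'.fst
  have htan : ⟪(γ s).1, v.1⟫ = 0 := isTangent_of_hasDerivAt hγ' (hm.mono fun u hu => hu.1)
  have hhor := hs.horizontal_le hγ' hm
  obtain ⟨hx, h0, hT⟩ := hm.self_of_nhds
  have hsnd : HasDerivAt (fun u => max a (min (γ u).2 b)) w.2 s := hc'.snd
  have hexp : 1 ≤ Real.exp (2 * a) := Real.one_le_exp (by positivity)
  have hnn : 0 ≤ G (γ s) (v.1, 0) (v.1, 0) := by
    rcases eq_or_ne v.1 0 with h | h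
    · have : ((0, 0) : Pt) = 0 := rfl
      simp [h, this]
    · exact (hs.metric.pos (γ s) hm.self_of_nhds (v.1, 0) htan (by simpa using h)).le
  have h1 : G (γ s) v v ≤ Real.exp (2 * a) * G (γ s) v v :=
    le_mul_of_one_le_left (hnn.trans hhor) hexp
  -- At height at most `a`, the clamped height takes its minimal value `a` at `s`, so its derivative
  -- vanishes; this also covers the corner `(γ s).2 = a`. Height at least `b` is symmetric.
  rcases le_or_gt (γ s).2 a with hsa | hsa
  · have hmin : IsLocalMin (fun u => max a (min (γ u).2 b)) s := by
      refine Eventually.of_forall fun u => ?_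
      beta_reduce
      rw [max_eq_left ((min_le_left _ _).trans hsa)]
      exact le_max_left _ _
    have hw' : w = (v.1, 0) := Prod.ext hfst (hmin.hasDerivAt_eq_zero hsnd)
    have hp : (clamp a b ∘ γ) s = ((γ s).1, a) := by
      simp [clamp, (min_le_left _ _).trans hsa]
    rw [hp, hw']
    have h2 := hs.leaf_le_exp_mul_leaf h0 hsa (hab.le.trans hb) hx
      (fun t ht => hA _ hx t (Or.inl ⟨h0.trans_lt ht.1, ht.2⟩)) htan
    refine h2.trans (mul_le_mul ?_ hhor hnn (Real.exp_pos _).le)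
    -- The growth factor `exp (2 (a - t))` is largest at `t = 0`.
    exact Real.exp_le_exp.2 (by linarith)
  rcases le_or_gt b (γ s).2 with hsb | hsb
  · have hmax : IsLocalMax (fun u => max a (min (γ u).2 b)) s := by
      refine Eventually.of_forall fun u => ?_
      beta_reduce
      rw [min_eq_right hsb, max_eq_right hab.le]
      exact max_le hab.le (min_le_right _ _)
    have hw' : w = (v.1, 0) := Prod.ext hfst (hmax.hasDerivAt_eq_zero hsnd)
    have hp : (clamp a b ∘ γ) s = ((γ s).1, b) := by
      simp [clamp, hsb, hab.le]
    rw [hp, hw']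
    have h2 := hs.leaf_le_leaf (ha.trans hab.le) hsb hT hx
      (fun t ht => hA _ hx t (Or.inr ⟨ht.1, ht.2.trans_le hT⟩)) htan
    exact (h2.trans hhor).trans h1
  · have hcont : ContinuousAt (fun u => (γ u).2) s := hγ'.continuousAt.snd
    have heq : clamp a b ∘ γ =ᶠ[𝓝 s] γ := by
      filter_upwards [hcont.eventually (Ioo_mem_nhds hsa hsb)] with u hu
      exact Prod.ext rfl (by simp [clamp, hu.1.le, hu.2.le])
    have hwv : w = v := heq.deriv_eq
    rw [hwv, heq.eq_of_nhds]
    exact h1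

theorem IsSolution.length_clamp_le (hs : IsSolution T G H) {a b : ℝ} (ha : 0 ≤ a) (hab : a < b)
    (hb : b ≤ T) (hA : ∀ x ∈ S2, ∀ t ∈ Ioo 0 a ∪ Ioo b T, SecondFundamentalFormPos G H (x, t))
    {p q : Pt} (hp : p ∈ region a b) (hq : q ∈ region a b) {γ : ℝ → Pt}
    (hγ : γ ∈ curves (region 0 T) p q) :
    length G (clamp a b ∘ γ) ≤ ENNReal.ofReal (Real.exp a) * length G γ := by
  have hcγ := clamp_comp_mem_curves hab.le (fun _ h => h.1) hp hq hγ
  unfold length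
  -- At interior parameters the Lipschitz curves are a.e. differentiable in the two-sided sense, so
  -- speeds can be compared pointwise there.
  rw [← lintegral_const_mul' _ _ ENNReal.ofReal_ne_top,
    Measure.restrict_congr_set Ioo_ae_eq_Icc.symm]
  refine lintegral_mono_ae ?_
  filter_upwards [ae_differentiableAt_of_mem_curves hγ, ae_differentiableAt_of_mem_curves hcγ,
    ae_restrict_mem measurableSet_Ioo] with s h1 h2 hsI
  have hm : ∀ᶠ u in 𝓝 s, γ u ∈ region 0 T := by
    filter_upwards [Ioo_mem_nhds hsI.1 hsI.2] with u hu using hγ.2.1 (Ioo_subset_Icc_self hu)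
  rw [← ENNReal.ofReal_mul (Real.exp_pos _).le]
  refine ENNReal.ofReal_le_ofReal ?_
  have e : Real.exp a = √(Real.exp (2 * a)) := by
    rw [two_mul, Real.exp_add, Real.sqrt_mul_self (Real.exp_pos _).le]
  rw [e, ← Real.sqrt_mul (Real.exp_pos _).le]
  exact Real.sqrt_le_sqrt (hs.clamp_speed_le ha hab hb hA h1 h2 hm)

theorem IsSolution.dist_region_le (hs : IsSolution T G H) {a b : ℝ} (ha : 0 ≤ a) (hab : a < b)
    (hb : b ≤ T) (hA : ∀ x ∈ S2, ∀ t ∈ Ioo 0 a ∪ Ioo b T, SecondFundamentalFormPos G H (x, t))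
    {p q : Pt} (hp : p ∈ region a b) (hq : q ∈ region a b) :
    dist G (region a b) p q ≤ ENNReal.ofReal (Real.exp a) * dist G (region 0 T) p q := by
  have h0 : ENNReal.ofReal (Real.exp a) ≠ 0 := by simp [Real.exp_pos]
  unfold dist
  rw [ENNReal.mul_iInf_of_ne h0 ENNReal.ofReal_ne_top]
  refine le_iInf fun γ => ?_
  rw [ENNReal.mul_iInf_of_ne h0 ENNReal.ofReal_ne_top]
  refine le_iInf fun hγ => ?_
  exact (iInf₂_le _ (clamp_comp_mem_curves hab.le (fun _ h => h.1) hp hq hγ)).trans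
    (hs.length_clamp_le ha hab hb hA hp hq hγ)

end Clamp

/-! ### Concatenation of curves and the triangle inequality. -/

section Triangle

/-- The concatenation of two curves parametrized by `[0,1]`. -/
noncomputable def concat (γ₁ γ₂ : ℝ → Pt) (s : ℝ) : Pt :=
  if s ≤ 1 / 2 then γ₁ (2 * s) else γ₂ (2 * s - 1)

theorem concat_mem_curves {U : Set Pt} {p m q : Pt} {γ₁ γ₂ : ℝ → Pt} (h₁ : γ₁ ∈ curves U p m)
    (h₂ : γ₂ ∈ curves U m q) : concat γ₁ γ₂ ∈ curves U p q := by
  obtain ⟨⟨C₁, hC₁⟩, hm₁, h₁0, h₁1⟩ := h₁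
  obtain ⟨⟨C₂, hC₂⟩, hm₂, h₂0, h₂1⟩ := h₂
  have low : ∀ {s : ℝ}, s ≤ 1 / 2 → concat γ₁ γ₂ s = γ₁ (2 * s) := fun h => if_pos h
  have high : ∀ {s : ℝ}, 1 / 2 ≤ s → concat γ₁ γ₂ s = γ₂ (2 * s - 1) := by
    intro s h
    rcases h.eq_or_lt with rfl | h
    · rw [low le_rfl]
      norm_num [h₁1, h₂0]
    · exact if_neg h.not_ge
  have lowL : ∀ {s u : ℝ}, s ∈ Icc (0 : ℝ) (1 / 2) → u ∈ Icc (0 : ℝ) (1 / 2) →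
      Dist.dist (concat γ₁ γ₂ s) (concat γ₁ γ₂ u) ≤ C₁ * (2 * |s - u|) := by
    intro s u hs hu
    rw [low hs.2, low hu.2]
    have := hC₁.dist_le_mul (2 * s) ⟨by linarith [hs.1], by linarith [hs.2]⟩ (2 * u)
      ⟨by linarith [hu.1], by linarith [hu.2]⟩
    rwa [Real.dist_eq, ← mul_sub, abs_mul, abs_two] at this
  have highL : ∀ {s u : ℝ}, s ∈ Icc (1 / 2 : ℝ) 1 → u ∈ Icc (1 / 2 : ℝ) 1 →
      Dist.dist (concat γ₁ γ₂ s) (concat γ₁ γ₂ u) ≤ C₂ * (2 * |s - u|) := by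
    intro s u hs hu
    rw [high hs.1, high hu.1]
    have := hC₂.dist_le_mul (2 * s - 1) ⟨by linarith [hs.1], by linarith [hs.2]⟩ (2 * u - 1)
      ⟨by linarith [hu.1], by linarith [hu.2]⟩
    rwa [Real.dist_eq, sub_sub_sub_cancel_right, ← mul_sub, abs_mul, abs_two] at this
  have key : ∀ {s u : ℝ}, s ∈ Icc (0 : ℝ) 1 → u ∈ Icc (0 : ℝ) 1 → s ≤ u →
      Dist.dist (concat γ₁ γ₂ s) (concat γ₁ γ₂ u) ≤ (2 * (C₁ + C₂) : ℝ) * Dist.dist s u := by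
    intro s u hs hu hsu
    have hc₁ := C₁.2
    have hc₂ := C₂.2
    rw [Real.dist_eq, abs_sub_comm, abs_of_nonneg (sub_nonneg.2 hsu)]
    rcases le_total u (1 / 2) with hu2 | hu2
    · have := lowL ⟨hs.1, hsu.trans hu2⟩ ⟨hu.1, hu2⟩
      rw [abs_sub_comm, abs_of_nonneg (sub_nonneg.2 hsu)] at this
      nlinarith [mul_nonneg hc₂ (sub_nonneg.2 hsu)]
    rcases le_total (1 / 2) s with hs2 | hs2
    · have := highL ⟨hs2, hs.2⟩ ⟨hu2, hu.2⟩
      rw [abs_sub_comm, abs_of_nonneg (sub_nonneg.2 hsu)] at this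
      nlinarith [mul_nonneg hc₁ (sub_nonneg.2 hsu)]
    -- The interval straddles `1/2`: compare both ends with the junction point.
    · have l := lowL ⟨hs.1, hs2⟩ ⟨by norm_num, le_rfl⟩
      have r := highL ⟨le_rfl, by norm_num⟩ ⟨hu2, hu.2⟩
      rw [abs_sub_comm, abs_of_nonneg (sub_nonneg.2 hs2)] at l
      rw [abs_sub_comm, abs_of_nonneg (sub_nonneg.2 hu2)] at r
      have := dist_triangle (concat γ₁ γ₂ s) (concat γ₁ γ₂ (1 / 2)) (concat γ₁ γ₂ u)
      nlinarith [mul_nonneg hc₁ (sub_nonneg.2 hu2), mul_nonneg hc₂ (sub_nonneg.2 hs2)]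
  refine ⟨⟨2 * (C₁ + C₂), LipschitzOnWith.of_dist_le_mul fun s hs u hu => ?_⟩, fun s hs => ?_, ?_,
    ?_⟩
  · push_cast
    rcases le_total s u with hsu | hsu
    · exact key hs hu hsu
    · rw [dist_comm, dist_comm s]
      exact key hu hs hsu
  · rcases le_total s (1 / 2) with h | h
    · rw [low h]
      exact hm₁ ⟨by linarith [hs.1], by linarith⟩
    · rw [high h]
      exact hm₂ ⟨by linarith, by linarith [hs.2]⟩
  · rw [low (by norm_num)]
    simpa using h₁0
  · rw [high (by norm_num)]
    norm_num [h₂1]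

theorem sqrt_form_two_smul (B : Pt →L[ℝ] Pt →L[ℝ] ℝ) (v : Pt) :
    √(B ((2 : ℝ) • v) ((2 : ℝ) • v)) = 2 * √(B v v) := by
  simp only [map_smul, smul_apply, smul_eq_mul]
  rw [← mul_assoc, Real.sqrt_mul (by norm_num), Real.sqrt_mul_self (by norm_num)]

theorem lintegral_Ioo_affine (f : ℝ → ℝ≥0∞) {c : ℝ} (hc : 0 < c) (d a b : ℝ) :
    ∫⁻ s in Ioo a b, ENNReal.ofReal c * f (c * s + d) =
      ∫⁻ s in Ioo (c * a + d) (c * b + d), f s := by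
  have h := lintegral_image_eq_lintegral_abs_deriv_mul (s := Ioo a b) (f := fun s => c * s + d)
    (f' := fun _ => c) measurableSet_Ioo
    (fun x _ => by simpa using (((hasDerivAt_id x).const_mul c).add_const d).hasDerivWithinAt)
    (fun x _ y _ hxy => by
      have : c * x + d = c * y + d := hxy
      exact mul_left_cancel₀ hc.ne' (add_right_cancel this)) f
  rw [image_affine_Ioo hc] at h
  rw [h, abs_of_pos hc]

theorem length_concat_le (G : BilinField) (γ₁ γ₂ : ℝ → Pt) :
    length G (concat γ₁ γ₂) ≤ length G γ₁ + length G γ₂ := by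
  -- Off the null set `{0, 1/2, 1}`, the concatenation agrees near each parameter with one
  -- reparametrized piece, which determines `deriv`.
  have hsub : Icc (0 : ℝ) 1 ≤ᵐ[volume] (Ioo (0 : ℝ) (1 / 2) ∪ Ioo (1 / 2 : ℝ) 1 : Set ℝ) := by
    have h0 : ∀ᵐ s : ℝ, s ∉ ({0, 1 / 2, 1} : Set ℝ) :=
      measure_eq_zero_iff_ae_notMem.1 ((Set.toFinite _).measure_zero _)
    filter_upwards [h0] with s hs hI
    simp only [mem_insert_iff, mem_singleton_iff, not_or] at hs
    rcases lt_or_gt_of_ne hs.2.1 with h | h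
    · exact Or.inl ⟨lt_of_le_of_ne hI.1 (Ne.symm hs.1), h⟩
    · exact Or.inr ⟨h, lt_of_le_of_ne hI.2 hs.2.2⟩
  unfold length
  refine (lintegral_mono' (Measure.restrict_mono_ae hsub) le_rfl).trans ?_
  refine (lintegral_union_le _ _ _).trans (add_le_add (le_of_eq ?_) (le_of_eq ?_))
  · have h := lintegral_Ioo_affine
      (fun s => ENNReal.ofReal √(G (γ₁ s) (deriv γ₁ s) (deriv γ₁ s))) two_pos 0 0 (1 / 2)
    norm_num at h
    rw [Measure.restrict_congr_set (Ioo_ae_eq_Icc (a := (0 : ℝ)) (b := 1)).symm, ← h]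
    norm_num
    refine setLIntegral_congr_fun measurableSet_Ioo fun s hs => ?_
    have heq : concat γ₁ γ₂ =ᶠ[𝓝 s] fun u => γ₁ (2 * u) := by
      filter_upwards [Iio_mem_nhds hs.2] with u hu
      refine if_pos ?_
      have : u < 2⁻¹ := by simpa using hu
      norm_num
      linarith
    have hd : deriv (concat γ₁ γ₂) s = (2 : ℝ) • deriv γ₁ (2 * s) := by
      rw [heq.deriv_eq, deriv_comp_mul_left]
    rw [hd, heq.eq_of_nhds, sqrt_form_two_smul, ENNReal.ofReal_mul two_pos.le]
    simp
  · have h := lintegral_Ioo_affine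
      (fun s => ENNReal.ofReal √(G (γ₂ s) (deriv γ₂ s) (deriv γ₂ s))) two_pos (-1) (1 / 2) 1
    norm_num at h
    rw [Measure.restrict_congr_set (Ioo_ae_eq_Icc (a := (0 : ℝ)) (b := 1)).symm, ← h]
    norm_num
    refine setLIntegral_congr_fun measurableSet_Ioo fun s hs => ?_
    have heq : concat γ₁ γ₂ =ᶠ[𝓝 s] fun u => γ₂ (2 * u - 1) := by
      filter_upwards [Ioi_mem_nhds hs.1] with u hu
      refine if_neg ?_
      have : 2⁻¹ < u := by simpa using hu
      norm_num
      linarith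
    have hd : deriv (concat γ₁ γ₂) s = (2 : ℝ) • deriv γ₂ (2 * s + -1) := by
      rw [heq.deriv_eq, deriv_comp_mul_left (f := fun u => γ₂ (u - 1)), deriv_comp_sub_const,
        sub_eq_add_neg]
    rw [hd, heq.eq_of_nhds, sub_eq_add_neg, sqrt_form_two_smul, ENNReal.ofReal_mul two_pos.le]
    simp

theorem dist_triangle_intrinsic (G : BilinField) (U : Set Pt) (p m q : Pt) :
    dist G U p q ≤ dist G U p m + dist G U m q := by
  conv_rhs => unfold dist
  simp only [ENNReal.iInf_add, ENNReal.add_iInf]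
  exact le_iInf₂ fun γ₁ h₁ => le_iInf₂ fun γ₂ h₂ =>
    (iInf₂_le _ (concat_mem_curves ‹_› ‹_›)).trans (length_concat_le G _ _)

theorem dist_mono (G : BilinField) {V U : Set Pt} (h : V ⊆ U) (p q : Pt) :
    dist G U p q ≤ dist G V p q :=
  le_iInf₂ fun γ hγ => iInf₂_le γ ⟨hγ.1, hγ.2.1.mono_right h, hγ.2.2⟩

end Triangle

/-! ### Diameter bound and the quantitative estimate. -/

section Bound

variable {T : ℝ} {G : BilinField} {H : Pt → ℝ}

/-- The vertical segments of the region have length at most the integral of a bound of `1 / H`. -/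
theorem IsSolution.dist_vertical_le (hs : IsSolution T G H) {h : ℝ → ℝ}
    (hH : ∀ x ∈ S2, ∀ t ∈ Ioo 0 T, 1 / H (x, t) ≤ h t) {x : E3} (hx : x ∈ S2) {t τ : ℝ}
    (ht : t ∈ Ioo 0 T) (hτ : τ ∈ Ioo 0 T) :
    dist G (region 0 T) (x, t) (x, τ) ≤ ∫⁻ s in Icc 0 T, ENNReal.ofReal (h s) := by
  let f : ℝ → ℝ := fun s => t + s * (τ - t)
  let γ : ℝ → Pt := fun s => (x, f s)
  have hf : ∀ s ∈ Icc (0 : ℝ) 1, f s ∈ Ioo 0 T := fun s hs => by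
    have := (convex_Ioo 0 T) ht hτ (sub_nonneg.2 hs.2) hs.1 (by ring)
    convert this using 1
    simp only [f, smul_eq_mul]
    ring
  have hf' : ∀ s, HasDerivAt f (τ - t) s := fun s => by
    simpa only [id_eq, one_mul] using ((hasDerivAt_id s).mul_const (τ - t)).const_add t
  have hγ' : ∀ s, deriv γ s = (0, τ - t) := fun s =>
    ((hasDerivAt_const s x).prodMk (hf' s)).deriv
  have hγ : γ ∈ curves (region 0 T) (x, t) (x, τ) := by
    refine ⟨⟨‖τ - t‖₊, LipschitzOnWith.of_dist_le_mul fun s _ u _ => ?_⟩,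
      fun s hs => ⟨hx, Ioo_subset_Icc_self (hf s hs)⟩, by simp [γ, f], by simp [γ, f]⟩
    have : f s - f u = (τ - t) * (s - u) := by
      simp only [f]
      ring
    simp [γ, Prod.dist_eq, Real.dist_eq, this, abs_mul]
    positivity
  refine (iInf₂_le γ hγ).trans ?_
  -- The constant segment is treated apart because the change of variables `u = f s` needs
  -- injectivity.
  rcases eq_or_ne τ t with rfl | hne
  · have h0 : ((0, 0) : Pt) = 0 := rfl
    simp [length, hγ', h0]
  calc length G γ
      = ∫⁻ s in Icc (0 : ℝ) 1, ENNReal.ofReal |τ - t| * ENNReal.ofReal (1 / H (x, f s)) := by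
        refine setLIntegral_congr_fun measurableSet_Icc fun s hsI => ?_
        have h0 : ((0, 0) : Pt) = 0 := rfl
        have hp := hs.pos x hx _ (hf s hsI)
        have e : G (γ s) (deriv γ s) (deriv γ s) = ((τ - t) / H (x, f s)) ^ 2 := by
          rw [hγ', hs.metric_split hx (hf s hsI) (inner_zero_right x), h0]
          simp
        rw [e, Real.sqrt_sq_eq_abs, abs_div, abs_of_pos hp, ← ENNReal.ofReal_mul (abs_nonneg _),
          mul_one_div]
    _ = ∫⁻ s in f '' Icc 0 1, ENNReal.ofReal (1 / H (x, s)) :=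
        (lintegral_image_eq_lintegral_abs_deriv_mul measurableSet_Icc
          (fun s _ => (hf' s).hasDerivWithinAt)
          (fun s _ u _ hsu => mul_right_cancel₀ (sub_ne_zero.2 hne) (add_left_cancel hsu))
          (fun s => ENNReal.ofReal (1 / H (x, s)))).symm
    _ ≤ ∫⁻ s in Ioo 0 T, ENNReal.ofReal (1 / H (x, s)) :=
        lintegral_mono_set (image_subset_iff.2 hf)
    _ ≤ ∫⁻ s in Ioo 0 T, ENNReal.ofReal (h s) :=
        setLIntegral_mono' measurableSet_Ioo fun s hs => ENNReal.ofReal_le_ofReal (hH x hx s hs)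
    _ ≤ ∫⁻ s in Icc 0 T, ENNReal.ofReal (h s) := lintegral_mono_set Ioo_subset_Icc_self

/-- Go vertically from `p` to the leaf of `q`, then inside that leaf. Both heights are interior,
where `1 / H ≤ h` controls vertical lengths. -/
theorem IsSolution.dist_region_le_diam_add (hs : IsSolution T G H) {h : ℝ → ℝ}
    (hH : ∀ x ∈ S2, ∀ t ∈ Ioo 0 T, 1 / H (x, t) ≤ h t) {p q : Pt} (hp : p ∈ S2 ×ˢ Ioo 0 T)
    (hq : q ∈ S2 ×ˢ Ioo 0 T) :
    dist G (region 0 T) p q ≤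
      (∫⁻ s in Icc 0 T, ENNReal.ofReal (h s)) + diam G (leaf q.2) := by
  refine (dist_triangle_intrinsic G _ p (p.1, q.2) q).trans
    (add_le_add (hs.dist_vertical_le hH hp.1 hp.2 hq.2) ?_)
  refine (dist_mono G (V := leaf q.2) ?_ _ _).trans ?_
  · exact prod_mono le_rfl (singleton_subset_iff.2 (Ioo_subset_Icc_self hq.2))
  · exact le_iSup₂_of_le (p.1, q.2) ⟨hp.1, rfl⟩
      (le_iSup₂_of_le (f := fun q' _ => dist G (leaf q.2) (p.1, q.2) q') q ⟨hq.1, rfl⟩ le_rfl)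

/-- Quantitative estimate: since `0 < A` and `tr A = H` give `0 ≤ ∂_t g ≤ 2 g` on the leaves outside
`[a,b]`, the retraction onto `S² × [a,b]` is `exp a`-Lipschitz, whence
`d_V - d_U ≤ (exp a - 1) diam U`. The bound is uniform over all solutions, so no convergence of the
leaves is needed. -/
theorem IsSolution.embeddingConstant_le (hs : IsSolution T G H) {h : ℝ → ℝ}
    (hH : ∀ x ∈ S2, ∀ t ∈ Ioo 0 T, 1 / H (x, t) ≤ h t) {D : ℝ≥0∞}
    (hD : ∀ t ∈ Icc 0 T, diam G (leaf t) ≤ D) {a b : ℝ} (ha : 0 < a) (hab : a < b) (hb : b < T)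
    (hA : ∀ x ∈ S2, ∀ t ∈ Ioo 0 a ∪ Ioo b T, SecondFundamentalFormPos G H (x, t)) :
    embeddingConstant G (region a b) (region 0 T) ≤
      ENNReal.ofReal (Real.exp a - 1) * ((∫⁻ s in Icc 0 T, ENNReal.ofReal (h s)) + D) := by
  have hI : Icc a b ⊆ Ioo 0 T := Icc_subset_Ioo ha hb
  refine iSup₂_le fun p hp => iSup₂_le fun q hq => ?_
  -- Written as a sum so that one copy of `d_U` cancels in the truncated subtraction of `ℝ≥0∞`.
  have hexp : ENNReal.ofReal (Real.exp a) = ENNReal.ofReal (Real.exp a - 1) + 1 := by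
    rw [← ENNReal.ofReal_one,
      ← ENNReal.ofReal_add (sub_nonneg.2 (Real.one_le_exp ha.le)) zero_le_one,
      sub_add_cancel]
  have h1 : dist G (region a b) p q - dist G (region 0 T) p q ≤
      ENNReal.ofReal (Real.exp a - 1) * dist G (region 0 T) p q := by
    rw [tsub_le_iff_right]
    refine (hs.dist_region_le ha.le hab hb.le hA hp hq).trans_eq ?_
    rw [hexp, add_mul, one_mul]
  refine h1.trans (mul_le_mul_right ?_ _)
  exact (hs.dist_region_le_diam_add hH ⟨hp.1, hI hp.2⟩ ⟨hq.1, hI hq.2⟩).trans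
    (add_le_add le_rfl (hD _ (Ioo_subset_Icc_self (hI hq.2))))

end Bound

end IMCF

/-! ### Passage to the limit. -/

theorem lemma3p8
    (T r₀ D : ℝ) (hr₀ : 0 < r₀)
    (t₁ t₂ : ℕ → ℝ)
    (ht₁_pos : ∀ k, 0 < t₁ k) (ht₁₂ : ∀ k, t₁ k < t₂ k) (ht₂_lt : ∀ k, t₂ k < T)
    (ht₁ : Tendsto t₁ atTop (𝓝 0)) (ht₂ : Tendsto t₂ atTop (𝓝 T))
    (G : ℕ → IMCF.BilinField) (H : ℕ → IMCF.Pt → ℝ)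
    (hsol : ∀ i, IMCF.IsSolution T (G i) (H i))
    (hdiam : ∀ i, ∀ t ∈ Icc 0 T, IMCF.diam (G i) (IMCF.leaf t) ≤ ENNReal.ofReal D)
    (h : ℝ → ℝ) (h_int : IntegrableOn h (Icc 0 T))
    (hH : ∀ i, ∀ x ∈ IMCF.S2, ∀ t ∈ Ioo 0 T, 1 / H i (x, t) ≤ h t)
    (hdist : ∀ θ₁ ∈ IMCF.S2, ∀ θ₂ ∈ IMCF.S2,
      IMCF.roundDist r₀ θ₁ θ₂ ≤
        liminf (fun i => IMCF.dist (G i) (IMCF.leaf 0) (θ₁, 0) (θ₂, 0)) atTop)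
    (hC0₁ : ∀ k, IMCF.LeafTendstoRound G (t₁ k) (r₀ * Real.exp (t₁ k / 2)))
    (hC0₂ : ∀ k, IMCF.LeafTendstoRound G (t₂ k) (r₀ * Real.exp (t₂ k / 2)))
    (K : ℕ)
    (hconv : ∀ i, ∀ p ∈ IMCF.region 0 T \
        (IMCF.region (t₁ K) (t₂ K) ∪ (IMCF.leaf 0 ∪ IMCF.leaf T)),
      IMCF.SecondFundamentalFormPos (G i) (H i) p) :
    Tendsto
      (fun k => limsup
        (fun i => IMCF.embeddingConstant (G i) (IMCF.region (t₁ k) (t₂ k)) (IMCF.region 0 T))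
        atTop)
      atTop (𝓝 0) := by

  set M : ℝ≥0∞ := (∫⁻ s in Icc 0 T, ENNReal.ofReal (h s)) + ENNReal.ofReal D with hM
  have hM_top : M ≠ ⊤ :=
    ENNReal.add_ne_top.2 ⟨h_int.lintegral_lt_top.ne, ENNReal.ofReal_ne_top⟩
  have hlim : Tendsto (fun k => ENNReal.ofReal (Real.exp (t₁ k) - 1) * M) atTop (𝓝 0) := by
    have h1 : Tendsto (fun k => Real.exp (t₁ k) - 1) atTop (𝓝 0) := by
      simpa using ((Real.continuous_exp.tendsto 0).comp ht₁).sub_const 1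
    -- Finiteness of `M` is needed for the product to be continuous at `0 · M`.
    have h2 := ENNReal.Tendsto.mul_const (ENNReal.tendsto_ofReal h1) (b := M) (Or.inr hM_top)
    simpa using h2
  refine tendsto_of_tendsto_of_tendsto_of_le_of_le' tendsto_const_nhds hlim
    (Eventually.of_forall fun _ => zero_le) ?_
  -- For large `k`, `t₁ k < t₁ K` and `t₂ K < t₂ k`, so every leaf that clamping crosses lies in the
  -- collars where `A > 0`.
  filter_upwards [ht₁.eventually_lt_const (ht₁_pos K), ht₂.eventually_const_lt (ht₂_lt K)]
    with k hk₁ hk₂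
  refine limsup_le_of_le (by isBoundedDefault) (Eventually.of_forall fun i => ?_)
  refine (hsol i).embeddingConstant_le (hH i) (hdiam i) (ht₁_pos k) (ht₁₂ k) (ht₂_lt k) ?_
  have hT : t₁ K < T := (ht₁₂ K).trans (ht₂_lt K)
  have h0 : 0 < t₂ K := (ht₁_pos K).trans (ht₁₂ K)
  rintro x hx t (ht | ht)
  · refine hconv i (x, t) ⟨⟨hx, ht.1.le, (ht.2.trans (hk₁.trans hT)).le⟩, ?_⟩
    rintro (h' | h' | h')
    · exact absurd h'.2.1 (ht.2.trans hk₁).not_ge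
    · exact ht.1.ne' h'.2
    · exact (ht.2.trans (hk₁.trans hT)).ne h'.2
  · refine hconv i (x, t) ⟨⟨hx, (h0.trans (hk₂.trans ht.1)).le, ht.2.le⟩, ?_⟩
    rintro (h' | h' | h')
    · exact absurd h'.2.2 (hk₂.trans ht.1).not_ge
    · exact (h0.trans (hk₂.trans ht.1)).ne' h'.2
    · exact ht.2.ne h'.2
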